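/- Let $\mathfrak X=\{1,\dots,n\}$ and let $\mathbf f(1),\dots,\mathbf f(n)\in\mathbb R^m$ be non-zero vectors that span $\mathbb R^m$. A design is a vector $\mathbf w\in\mathbb R^n$ with non-negative components summing to one; $\mathrm{supp}(\mathbf w)=\{x: w_x>0\}$, $\mathbf M(\mathbf w)=\sum_{x} w_x\mathbf f(x)\mathbf f(x)^{\top}$, and $\mathbf w$ is regular if $\mathbf M(\mathbf w)$ is non-singular. Let $\Phi_D(\mathbf M)=(\det \mathbf M)^{1/m}$ for non-negative definite $\mathbf M$. A design is D-optimal if it maximizes $\Phi_D(\mathbf M(\cdot))$ over all designs, and $\Phi^*$ denotes this maximal value. For a regular design $\mathbf w$ put $d_{u,v}(\mathbf w)=\mathbf f(u)^{\top}\mathbf M(\mathbf w)^{-1}\mathbf f(v)$ and $d_x(\mathbf w)=d_{x,x}(\mathbf w)$. The step-length $\alpha^*_{u,v}(\mathbf w)$ is $$\alpha^*_{u,v}(\mathbf w)=\min\Big\{w_u,\max\Big\{-w_v,\frac{d_v(\mathbf w)-d_u(\mathbf w)}{2[d_u(\mathbf w)d_v(\mathbf w)-d_{u,v}^2(\mathbf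 w)]}\Big\}\Big\}$$ if $\mathbf f(u),\mathbf f(v)$ are linearly independent; if they are linearly dependent, it is $w_u$, $0$ or $-w_v$ according to whether $d_u(\mathbf w)<d_v(\mathbf w)$, $d_u(\mathbf w)=d_v(\mathbf w)$ or $d_u(\mathbf w)>d_v(\mathbf w)$. The exchange between $u$ and $v$ replaces $\mathbf w$ by $\mathbf w+\alpha^*_{u,v}(\mathbf w)(\mathbf e_v-\mathbf e_u)$; it is called nullifying if $\alpha^*_{u,v}(\mathbf w)\in\{w_u,-w_v\}$. Fix $\gamma\ge 1/m$ and put $L=\min(\lfloor\gamma m\rfloor,n)$. The algorithm REX starts from an arbitrary regular design $\mathbf w^0$. Its iteration $i=0,1,2,\dots$ consists of the following steps. 1. Leading Böhning exchange: choose $k\in\mathrm{argmin}\{d_u(\mathbf w^i):u\in\mathrm{supp}(\mathbf w^i)\}$ and $l\in\mathrm{argmax}\{d_v(\mathbf w^i):v\in\mathfrak X\}$, and let $\mathbf v^i$ be the result of the exchange between $k$ and $l$ in $\mathbf w^i$. 2. Let $(k_1,\dots,k_K)$ be a random permutation of $\mathrm{supp}(\mathbf v^i)$ and $(l_1,\dots,l_L)$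 a random permutation of the indices of the $L$ largest components of $\mathbf d=(d_x)_{x\in\mathfrak X}$ (evaluated at $\mathbf w^i$ or at $\mathbf v^i$). 3. Starting from $\mathbf v^i$, go through the pairs $(k_1,l_1),(k_2,l_1),\dots,(k_K,l_1),\dots,(k_1,l_L),\dots,(k_K,l_L)$ in this order and perform, for each pair, the exchange in the then current design, except that, if the leading exchange was nullifying, the non-nullifying exchanges are skipped. The final design is $\mathbf w^{i+1}$. **Theorem.** A D-optimal design exists and, for every run of REX without a stopping rule (that is, for every regular initial design, every outcome of the random permutations and every way of breaking ties in the argmin, the argmax and the selection of the $L$ largest components), $$\lim_{i\to\infty}\Phi_D(\mathbf M(\mathbf w^i))=\lim_{i\to\infty}\Phi_D(\mathbf M(\mathbf v^i))=\Phi^* .$$ -/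

import Mathlib

open Filter Topology

namespace Rex

noncomputable section

variable {n m : ℕ}

/-- The information matrix `M(w) = ∑ₓ wₓ f(x) f(x)ᵀ`. -/
def infoMatrix (f : Fin n → Fin m → ℝ) (w : Fin n → ℝ) : Matrix (Fin m) (Fin m) ℝ :=
  ∑ x, w x • Matrix.vecMulVec (f x) (f x)

/-- The criterion of D-optimality `Φ_D(M) = det(M)^(1/m)` for non-negative definite `M`
(for `m ≥ 1` it is `0` at a singular matrix). -/
def phiD (M : Matrix (Fin m) (Fin m) ℝ) : ℝ :=
  M.det ^ (1 / (m : ℝ))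

/-- `w` is a design (an element of the probability simplex) with non-singular information
matrix. -/
def IsRegularDesign (f : Fin n → Fin m → ℝ) (w : Fin n → ℝ) : Prop :=
  w ∈ stdSimplex ℝ (Fin n) ∧ (infoMatrix f w).det ≠ 0

/-- `w` maximizes `Φ_D(M(·))` over all designs. -/
def IsDOptimal (f : Fin n → Fin m → ℝ) (w : Fin n → ℝ) : Prop :=
  w ∈ stdSimplex ℝ (Fin n) ∧
    ∀ w' ∈ stdSimplex ℝ (Fin n), phiD (infoMatrix f w') ≤ phiD (infoMatrix f w)

/-- `d_{u,v}(w) = f(u)ᵀ M(w)⁻¹ f(v)`. -/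
def crossVar (f : Fin n → Fin m → ℝ) (w : Fin n → ℝ) (u v : Fin n) : ℝ :=
  dotProduct (f u) (Matrix.mulVec (infoMatrix f w)⁻¹ (f v))

/-- The variance function `d_x(w) = f(x)ᵀ M(w)⁻¹ f(x)`. -/
def varFun (f : Fin n → Fin m → ℝ) (w : Fin n → ℝ) (x : Fin n) : ℝ :=
  crossVar f w x x

open Classical in
/-- The closed-form D-optimal step-length `α*_{u,v}(w)`: the first formula is for linearly
independent, the three-case formula for linearly dependent `f(u), f(v)`. -/
def stepLength (f : Fin n → Fin m → ℝ) (w : Fin n → ℝ) (u v : Fin n) : ℝ :=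
  if LinearIndependent ℝ ![f u, f v] then
    min (w u) (max (-(w v))
      ((varFun f w v - varFun f w u) /
        (2 * (varFun f w u * varFun f w v - crossVar f w u v ^ 2))))
  else if varFun f w u < varFun f w v then w u
  else if varFun f w u = varFun f w v then 0
  else -(w v)

/-- The D-optimal vertex-exchange step `w + α*_{u,v}(w) (e_v - e_u)`. -/
def exchange (f : Fin n → Fin m → ℝ) (w : Fin n → ℝ) (u v : Fin n) : Fin n → ℝ :=
  w + stepLength f w u v • (Pi.single v 1 - Pi.single u 1)

/-- The D-optimal exchange between `u` and `v` at `w` is nullifying. -/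
def IsNullifying (f : Fin n → Fin m → ℝ) (w : Fin n → ℝ) (u v : Fin n) : Prop :=
  stepLength f w u v = w u ∨ stepLength f w u v = -(w v)

/-- `k` minimizes the variance function over the support of `w` and `l` maximizes it over all
design points; ties may be broken in any way. -/
def IsBohningPair (f : Fin n → Fin m → ℝ) (w : Fin n → ℝ) (k l : Fin n) : Prop :=
  (0 < w k ∧ ∀ u, 0 < w u → varFun f w k ≤ varFun f w u) ∧
    ∀ v, varFun f w v ≤ varFun f w l

/-- `ks` lists the support of `w`, without repetition, in some order. -/
def IsSupportOrdering (w : Fin n → ℝ) (ks : List (Fin n)) : Prop :=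
  ks.Nodup ∧ ∀ x, x ∈ ks ↔ 0 < w x

/-- `ls` lists, without repetition and in some order, `L` design points at which `g` takes its
`L` largest values; ties may be broken in any way. -/
def IsGreedyOrdering (g : Fin n → ℝ) (L : ℕ) (ls : List (Fin n)) : Prop :=
  ls.Nodup ∧ ls.length = L ∧ ∀ x ∈ ls, ∀ y, y ∉ ls → g y ≤ g x

/-- The sequence `(k₁,l₁), (k₂,l₁), …, (k_K,l₁), …, (k₁,l_L), …, (k_K,l_L)`. -/
def batchPairs (ks ls : List (Fin n)) : List (Fin n × Fin n) :=
  ls.flatMap fun l => ks.map fun k => (k, l)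

open Classical in
/-- Sequentially perform the D-optimal exchanges along the list of pairs, each computed at the
design that is current at that moment; if `lbeNull` holds, only the nullifying ones among them
are performed. -/
def batchUpdate (f : Fin n → Fin m → ℝ) (lbeNull : Prop) (w : Fin n → ℝ)
    (pairs : List (Fin n × Fin n)) : Fin n → ℝ :=
  pairs.foldl
    (fun z p => if ¬ lbeNull ∨ IsNullifying f z p.1 p.2 then exchange f z p.1 p.2 else z) w

/-- The batch size parameter `L = min(γ m, n)` (with `γ m` rounded down to an integer). -/
def batchSize (n m : ℕ) (γ : ℝ) : ℕ :=
  min ⌊γ * (m : ℝ)⌋₊ n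

/-- One iteration of REX for D-optimality: `w` is the design at its beginning, `v` the design
after the leading Böhning exchange, `w'` the design after the subsequent batch of exchanges.
The orderings `ks` and `ls` are the outcomes of the random permutations. The variance function
that ranks the points for the greedy set may be the one computed before or the one recomputed
after the leading exchange. -/
def IsIteration (f : Fin n → Fin m → ℝ) (γ : ℝ) (w v w' : Fin n → ℝ) : Prop :=
  ∃ (k l : Fin n) (ks ls : List (Fin n)),
    IsBohningPair f w k l ∧
    v = exchange f w k l ∧
    IsSupportOrdering v ks ∧
    (IsGreedyOrdering (varFun f w) (batchSize n m γ) ls ∨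
      IsGreedyOrdering (varFun f v) (batchSize n m γ) ls) ∧
    w' = batchUpdate f (IsNullifying f w k l) v (batchPairs ks ls)

/-- A run of REX for D-optimality without stopping rule: `w i` is the design after `i` complete
iterations (`w 0` is the initial regular design), and `v i` is the design produced by the leading
Böhning exchange applied to `w i`. -/
structure IsRun (f : Fin n → Fin m → ℝ) (γ : ℝ) (w v : ℕ → Fin n → ℝ) : Prop where
  init : IsRegularDesign f (w 0)
  iter : ∀ i, IsIteration f γ (w i) (v i) (w (i + 1))

end

end Rex

namespace Rex

open Matrix

variable {n m : ℕ}

/-! Every exchange weakly increases the determinant, which is bounded by its optimal value, so it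
converges along the run to some ψ > 0. The arithmetic-geometric mean inequality gives Φ* ≤ Φ_D(M(w))
· max d(w) / m (`phiD_infoMatrix_le`); if ψ were suboptimal, max d would therefore stay above m + δ
for a fixed δ > 0. The minimum of d on the support is at most m, the w-average of d, so each leading
exchange strictly increases the determinant.

A non-nullifying leading exchange would gain at least a fixed factor 1 + c
(`IsBohningPair.le_exchangeGain`), which convergence allows only finitely often. Once all leading
exchanges are nullifying, so are all exchanges performed. Each just moves the whole weight of one
point to another, so every later design is the image of one fixed design under a self-map of a
finite set. Finitely many designs contradict a strictly increasing determinant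
(`IsRun.not_forall_le_varFun`). -/

lemma det_rpow_le_trace_div {N : Matrix (Fin m) (Fin m) ℝ} (hm : 0 < m) (hN : N.PosSemidef) :
    N.det ^ (1 / (m : ℝ)) ≤ N.trace / m := by
  have hm' : (m : ℝ) ≠ 0 := by positivity
  have h := Real.geom_mean_le_arith_mean_weighted Finset.univ (fun _ : Fin m => 1 / (m : ℝ))
    hN.1.eigenvalues (fun _ _ => by positivity) (by simp [hm']) (fun i _ => hN.eigenvalues_nonneg i)
  rw [Real.finsetProd_rpow _ _ (fun i _ => hN.eigenvalues_nonneg i), ← Finset.mul_sum] at h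
  have h1 : N.det = ∏ i, hN.1.eigenvalues i := by simpa using hN.1.det_eq_prod_eigenvalues
  have h2 : N.trace = ∑ i, hN.1.eigenvalues i := by simpa using hN.1.trace_eq_sum_eigenvalues
  rw [h1, h2]
  exact h.trans_eq (by ring)

open scoped MatrixOrder in
-- With M⁻¹ = BᴴB, the matrix BNBᴴ has determinant det N / det M and trace tr(M⁻¹N); the mean
-- inequality is applied to it.
lemma phiD_le_mul_trace {M N : Matrix (Fin m) (Fin m) ℝ} (hm : 0 < m) (hM : M.PosDef)
    (hN : N.PosSemidef) : phiD N ≤ phiD M * ((M⁻¹ * N).trace / m) := by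
  obtain ⟨B, hB⟩ := CStarAlgebra.nonneg_iff_eq_star_mul_self.mp hM.inv.posSemidef.nonneg
  have hdM : 0 < M.det := hM.det_pos
  have hBN := hN.mul_mul_conjTranspose_same B
  have hdet : N.det = M.det * (B * N * Bᴴ).det := by
    have h1 : M.det * (star B * B).det = 1 := by
      rw [← hB, ← det_mul, mul_nonsing_inv _ hdM.ne'.isUnit, det_one]
    rw [det_mul] at h1
    rw [det_mul, det_mul, ← star_eq_conjTranspose]
    linear_combination (-N.det) * h1
  have htr : (B * N * Bᴴ).trace = (M⁻¹ * N).trace := by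
    rw [hB, trace_mul_comm, ← Matrix.mul_assoc, star_eq_conjTranspose]
  rw [phiD, hdet, Real.mul_rpow hdM.le hBN.det_nonneg, ← htr]
  exact mul_le_mul_of_nonneg_left (det_rpow_le_trace_div hm hBN) (Real.rpow_nonneg hdM.le _)

lemma infoMatrix_posSemidef (f : Fin n → Fin m → ℝ) {w : Fin n → ℝ} (hw : ∀ x, 0 ≤ w x) :
    (infoMatrix f w).PosSemidef :=
  posSemidef_sum _ fun x _ => by simpa using (posSemidef_vecMulVec_self_star (f x)).smul (hw x)

lemma IsRegularDesign.posDef {f : Fin n → Fin m → ℝ} {w : Fin n → ℝ} (h : IsRegularDesign f w) :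
    (infoMatrix f w).PosDef :=
  (infoMatrix_posSemidef f h.1.1).posDef_iff_det_ne_zero.mpr h.2

lemma trace_mul_infoMatrix (f : Fin n → Fin m → ℝ) (A : Matrix (Fin m) (Fin m) ℝ)
    (w : Fin n → ℝ) : (A * infoMatrix f w).trace = ∑ x, w x * (f x ⬝ᵥ A *ᵥ f x) := by
  simp [infoMatrix, Matrix.mul_sum, trace_sum, mul_vecMulVec, dotProduct_comm]

lemma sum_mul_varFun {f : Fin n → Fin m → ℝ} {w : Fin n → ℝ} (h : IsRegularDesign f w) :
    ∑ x, w x * varFun f w x = m := by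
  have := trace_mul_infoMatrix f (infoMatrix f w)⁻¹ w
  rw [nonsing_inv_mul _ (isUnit_iff_ne_zero.mpr h.2), trace_one, Fintype.card_fin] at this
  exact this.symm

/-- tr(M(w)⁻¹M(w')) is the w'-average of the variance function of w. -/
lemma phiD_infoMatrix_le {f : Fin n → Fin m → ℝ} {w w' : Fin n → ℝ} {l : Fin n} (hm : 0 < m)
    (h : IsRegularDesign f w) (h' : w' ∈ stdSimplex ℝ (Fin n))
    (hl : ∀ x, varFun f w x ≤ varFun f w l) :
    phiD (infoMatrix f w') ≤ phiD (infoMatrix f w) * (varFun f w l / m) := by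
  refine (phiD_le_mul_trace hm h.posDef (infoMatrix_posSemidef f h'.1)).trans ?_
  rw [trace_mul_infoMatrix]
  refine mul_le_mul_of_nonneg_left ?_ (Real.rpow_nonneg h.posDef.det_pos.le _)
  gcongr
  calc ∑ x, w' x * (f x ⬝ᵥ (infoMatrix f w)⁻¹ *ᵥ f x)
      ≤ ∑ x, w' x * varFun f w l :=
        Finset.sum_le_sum fun x _ => mul_le_mul_of_nonneg_left (hl x) (h'.1 x)
    _ = varFun f w l := by rw [← Finset.sum_mul, h'.2, one_mul]

lemma exists_isDOptimal (f : Fin n → Fin m → ℝ) (hn : 0 < n) : ∃ w, IsDOptimal f w := by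
  have hc : Continuous fun w : Fin n → ℝ => phiD (infoMatrix f w) := by
    have : Continuous fun w : Fin n → ℝ => infoMatrix f w := by
      unfold infoMatrix; fun_prop
    exact this.matrix_det.rpow_const fun _ => Or.inr (by positivity)
  obtain ⟨w, hw, h⟩ := (isCompact_stdSimplex ℝ (Fin n)).exists_isMaxOn
    ⟨_, single_mem_stdSimplex ℝ (⟨0, hn⟩ : Fin n)⟩ hc.continuousOn
  exact ⟨w, hw, h⟩

/-! ### Gram determinants and the determinant after an exchange -/

lemma crossVar_comm (f : Fin n → Fin m → ℝ) {w : Fin n → ℝ} (h : IsRegularDesign f w)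
    (u v : Fin n) : crossVar f w u v = crossVar f w v u := by
  have hs : ((infoMatrix f w)⁻¹)ᵀ = (infoMatrix f w)⁻¹ := by simpa using h.posDef.inv.1.eq
  rw [crossVar, crossVar, dotProduct_mulVec, ← mulVec_transpose, hs, dotProduct_comm]

lemma crossVar_lincomb_pos {f : Fin n → Fin m → ℝ} {w : Fin n → ℝ} (h : IsRegularDesign f w)
    {u v : Fin n} {a b : ℝ} (hab : a • f u + b • f v ≠ 0) :
    0 < a ^ 2 * varFun f w u + 2 * a * b * crossVar f w u v + b ^ 2 * varFun f w v := by
  have hp := h.posDef.inv.dotProduct_mulVec_pos hab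
  have hs := crossVar_comm f h u v
  simp only [star_trivial, mulVec_add, mulVec_smul, dotProduct_add, add_dotProduct,
    smul_dotProduct, dotProduct_smul, smul_eq_mul] at hp
  simp only [varFun, crossVar] at hs ⊢
  linear_combination hp - a * b * hs

lemma varFun_pos {f : Fin n → Fin m → ℝ} {w : Fin n → ℝ} (h : IsRegularDesign f w)
    {u : Fin n} (hu : f u ≠ 0) : 0 < varFun f w u := by
  simpa using crossVar_lincomb_pos h (u := u) (v := u) (a := 1) (b := 0) (by simpa using hu)

lemma gram_pos {f : Fin n → Fin m → ℝ} {w : Fin n → ℝ} (h : IsRegularDesign f w)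
    {u v : Fin n} (hl : LinearIndependent ℝ ![f u, f v]) :
    0 < varFun f w u * varFun f w v - crossVar f w u v ^ 2 := by
  have hu : 0 < varFun f w u := varFun_pos h (hl.ne_zero 0)
  -- With these coefficients the quadratic form equals d_u (d_u d_v - d_{u,v}²).
  have hne : crossVar f w u v • f u + (-varFun f w u) • f v ≠ 0 := fun h0 =>
    hu.ne' (by simpa using (LinearIndependent.pair_iff.mp hl _ _ h0).2)
  have := crossVar_lincomb_pos h hne
  refine pos_of_mul_pos_right (a := varFun f w u) ?_ hu.le
  linear_combination this

lemma gram_eq_zero {f : Fin n → Fin m → ℝ} {w : Fin n → ℝ} {u v : Fin n} (hu : f u ≠ 0)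
    (hl : ¬ LinearIndependent ℝ ![f u, f v]) :
    varFun f w u * varFun f w v - crossVar f w u v ^ 2 = 0 := by
  have h : ¬ ∀ a : ℝ, a • f u ≠ f v := fun h => hl ((LinearIndependent.pair_iff' hu).mpr h)
  push Not at h
  obtain ⟨a, ha⟩ := h
  simp only [varFun, crossVar, ← ha, mulVec_smul, dotProduct_smul, smul_dotProduct, smul_eq_mul]
  ring

/-- Factoring the rank-two update through dimension 2 lets the matrix determinant lemma reduce the
new determinant to a 2 × 2 one. -/
lemma infoMatrix_add_smul_single (f : Fin n → Fin m → ℝ) (w : Fin n → ℝ) (a : ℝ) (u v : Fin n) :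
    infoMatrix f (w + a • (Pi.single v 1 - Pi.single u 1)) =
      infoMatrix f w + (of ![a • f v, -a • f u])ᵀ * of ![f v, f u] := by
  have : (of ![a • f v, -a • f u])ᵀ * of ![f v, f u] =
      a • (vecMulVec (f v) (f v) - vecMulVec (f u) (f u)) := by
    ext i j
    simp [mul_apply, Fin.sum_univ_two, vecMulVec_apply]
    ring
  rw [this]
  simp [infoMatrix, add_smul, Finset.sum_add_distrib, mul_smul, sub_smul, ← Finset.smul_sum,
    Finset.sum_sub_distrib, Pi.single_apply]

lemma det_infoMatrix_add_smul_single {f : Fin n → Fin m → ℝ} {w : Fin n → ℝ}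
    (h : IsRegularDesign f w) (a : ℝ) (u v : Fin n) :
    (infoMatrix f (w + a • (Pi.single v 1 - Pi.single u 1))).det =
      (infoMatrix f w).det * (1 + (a * (varFun f w v - varFun f w u) -
        a ^ 2 * (varFun f w u * varFun f w v - crossVar f w u v ^ 2))) := by
  have key : ∀ i j, (of ![f v, f u] * (infoMatrix f w)⁻¹ * (of ![a • f v, -a • f u])ᵀ) i j =
      ![f v, f u] i ⬝ᵥ (infoMatrix f w)⁻¹ *ᵥ ![a • f v, -a • f u] j := fun i j => by
    rw [Matrix.mul_assoc]; rfl
  rw [infoMatrix_add_smul_single, det_add_mul _ _ (isUnit_iff_ne_zero.mpr h.2), det_fin_two]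
  simp only [Matrix.add_apply, key]
  have hs := crossVar_comm f h v u
  simp [mulVec_smul, mulVec_neg]
  simp only [varFun, crossVar] at hs ⊢
  rw [hs]
  exact Or.inl (by ring)

end Rex

namespace Rex

variable {n m : ℕ} {f : Fin n → Fin m → ℝ} {w : Fin n → ℝ}

/-! ### Gain of a single exchange -/

lemma stepLength_mem_Icc (f : Fin n → Fin m → ℝ) (hw : ∀ x, 0 ≤ w x) (u v : Fin n) :
    stepLength f w u v ∈ Set.Icc (-(w v)) (w u) := by
  have hu := hw u
  have hv := hw v
  unfold stepLength
  split_ifs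
  · exact ⟨le_min (by linarith) (le_max_left _ _), min_le_left _ _⟩
  all_goals constructor <;> linarith

/-- The relative increase of the determinant achieved by the exchange between `u` and `v`. -/
noncomputable def exchangeGain (f : Fin n → Fin m → ℝ) (w : Fin n → ℝ) (u v : Fin n) : ℝ :=
  stepLength f w u v * (varFun f w v - varFun f w u) -
    stepLength f w u v ^ 2 * (varFun f w u * varFun f w v - crossVar f w u v ^ 2)

lemma det_exchange (h : IsRegularDesign f w) (u v : Fin n) :
    (infoMatrix f (exchange f w u v)).det =
      (infoMatrix f w).det * (1 + exchangeGain f w u v) :=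
  det_infoMatrix_add_smul_single h _ u v

/-- In the independent case the gain is C α (2a - α), where C > 0 is the Gram determinant, a the
vertex of the parabola and α its truncation to an interval containing 0; so α lies between 0 and a.
In the dependent case C = 0 and the gain is linear in α. -/
lemma exchangeGain_nonneg (hne : ∀ x, f x ≠ 0) (h : IsRegularDesign f w) (u v : Fin n) :
    0 ≤ exchangeGain f w u v := by
  have hu := h.1.1 u
  have hv := h.1.1 v
  unfold exchangeGain
  by_cases hl : LinearIndependent ℝ ![f u, f v]
  · have hC := gram_pos h hl
    rw [stepLength, if_pos hl]
    set C := varFun f w u * varFun f w v - crossVar f w u v ^ 2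
    set Δ := varFun f w v - varFun f w u
    set a := Δ / (2 * C) with ha
    have hΔ : Δ = 2 * C * a := by rw [ha]; field_simp
    suffices h' : 0 ≤ min (w u) (max (-(w v)) a) * (2 * a - min (w u) (max (-(w v)) a)) by
      rw [hΔ]
      nlinarith [mul_nonneg hC.le h']
    rcases le_total 0 a with h0 | h0
    · rw [max_eq_right (by linarith)]
      exact mul_nonneg (le_min hu h0) (by linarith [min_le_right (w u) a])
    · rw [min_eq_right ((max_le (by linarith) h0).trans hu)]
      exact mul_nonneg_of_nonpos_of_nonpos (max_le (by linarith) h0)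
        (by linarith [le_max_right (-(w v)) a])
  · rw [gram_eq_zero (hne u) hl, mul_zero, sub_zero, stepLength, if_neg hl]
    split_ifs with h1 h2
    · exact mul_nonneg hu (by linarith)
    · simp
    · exact mul_nonneg_of_nonpos_of_nonpos (by linarith) (by linarith [not_lt.mp h1])

lemma exchangeGain_pos (hne : ∀ x, f x ≠ 0) (h : IsRegularDesign f w) {u v : Fin n}
    (hu : 0 < w u) (hd : varFun f w u < varFun f w v) : 0 < exchangeGain f w u v := by
  have hv := h.1.1 v
  unfold exchangeGain
  by_cases hl : LinearIndependent ℝ ![f u, f v]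
  · have hC := gram_pos h hl
    rw [stepLength, if_pos hl]
    set C := varFun f w u * varFun f w v - crossVar f w u v ^ 2
    have ha : 0 < (varFun f w v - varFun f w u) / (2 * C) := div_pos (by linarith) (by linarith)
    set Δ := varFun f w v - varFun f w u
    set a := Δ / (2 * C) with ha'
    have hΔ : Δ = 2 * C * a := by rw [ha']; field_simp
    rw [max_eq_right (by linarith), hΔ]
    have hα : 0 < min (w u) a := lt_min hu ha
    have : 0 < C * (min (w u) a * (2 * a - min (w u) a)) :=
      mul_pos hC (mul_pos hα (by linarith [min_le_right (w u) a]))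
    linear_combination this
  · rw [gram_eq_zero (hne u) hl, mul_zero, sub_zero, stepLength, if_neg hl, if_pos hd]
    exact mul_pos hu (by linarith)

/-- Without truncation the step is the vertex of the parabola. -/
lemma exchangeGain_of_not_isNullifying (h : IsRegularDesign f w) {u v : Fin n}
    (hd : varFun f w u < varFun f w v) (hnull : ¬ IsNullifying f w u v) :
    0 < varFun f w u * varFun f w v - crossVar f w u v ^ 2 ∧
    exchangeGain f w u v = (varFun f w v - varFun f w u) ^ 2 /
      (4 * (varFun f w u * varFun f w v - crossVar f w u v ^ 2)) := by
  have hl : LinearIndependent ℝ ![f u, f v] := by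
    by_contra hl
    exact hnull (Or.inl (by rw [stepLength, if_neg hl, if_pos hd]))
  have hC := gram_pos h hl
  refine ⟨hC, ?_⟩
  have hs : stepLength f w u v = (varFun f w v - varFun f w u) /
      (2 * (varFun f w u * varFun f w v - crossVar f w u v ^ 2)) := by
    rw [IsNullifying, stepLength, if_pos hl] at hnull
    rw [stepLength, if_pos hl]
    grind
  rw [exchangeGain, hs]
  field_simp
  ring

lemma IsBohningPair.varFun_le {k l : Fin n} (hb : IsBohningPair f w k l)
    (h : IsRegularDesign f w) : varFun f w k ≤ m := by
  rw [← sum_mul_varFun h]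
  calc varFun f w k = ∑ x, w x * varFun f w k := by rw [← Finset.sum_mul, h.1.2, one_mul]
    _ ≤ _ := Finset.sum_le_sum fun x _ => by
      rcases (h.1.1 x).eq_or_lt with h0 | h0
      · simp [← h0]
      · exact mul_le_mul_of_nonneg_left (hb.1.2 x h0) h0.le

/-- Dropping d_{k,l}² and using d_k ≤ m bounds the Gram determinant by m d_l; then (b - m)² / (4mb)
increases in b ≥ m, so b = m + δ is the worst case. -/
lemma IsBohningPair.le_exchangeGain (hne : ∀ x, f x ≠ 0) {k l : Fin n}
    (hb : IsBohningPair f w k l) (h : IsRegularDesign f w) {δ : ℝ} (hδ : 0 < δ)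
    (hl : m + δ ≤ varFun f w l) (hnull : ¬ IsNullifying f w k l) :
    δ ^ 2 / (4 * (m * (m + δ))) ≤ exchangeGain f w k l := by
  have hk := hb.varFun_le h
  have hk0 := varFun_pos h (hne k)
  obtain ⟨hC, hg⟩ := exchangeGain_of_not_isNullifying h (by linarith) hnull
  rw [hg]
  set a := varFun f w k
  set b := varFun f w l
  have hm : (0 : ℝ) < m := hk0.trans_le hk
  have hCle : a * b - crossVar f w k l ^ 2 ≤ m * b := by
    nlinarith [sq_nonneg (crossVar f w k l)]
  calc δ ^ 2 / (4 * (m * (m + δ))) ≤ (b - m) ^ 2 / (4 * (m * b)) := by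
        rw [div_le_div_iff₀ (by positivity) (by nlinarith)]
        obtain ⟨t, ht, hbt⟩ : ∃ t, 0 ≤ t ∧ b = m + δ + t := ⟨b - (m + δ), by linarith, by ring⟩
        rw [hbt]
        -- Up to the factor 4, this is the difference of the cross-multiplied sides.
        have : 0 ≤ m * (m * δ * t * 2 + m * t ^ 2 + δ * t * (δ + t)) := by positivity
        nlinarith
    _ ≤ (b - a) ^ 2 / (4 * (m * b)) := by
        have : 0 < b := by linarith
        gcongr
        linarith
    _ ≤ _ := by gcongr

lemma IsRegularDesign.exchange (hne : ∀ x, f x ≠ 0) (h : IsRegularDesign f w) (u v : Fin n) :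
    IsRegularDesign f (exchange f w u v) := by
  refine ⟨⟨fun x => ?_, ?_⟩, ?_⟩
  · have hs := stepLength_mem_Icc f h.1.1 u v
    have := h.1.1 x
    have hu := hs.2
    have hv := hs.1
    simp only [Rex.exchange, Pi.add_apply, Pi.smul_apply, Pi.sub_apply, Pi.single_apply,
      smul_eq_mul]
    split_ifs with h1 h2 h2 <;> subst_vars <;> linarith
  · simp [Rex.exchange, Finset.sum_add_distrib, ← Finset.mul_sum, h.1.2]
  · rw [det_exchange h]
    have := exchangeGain_nonneg hne h u v
    exact mul_ne_zero h.2 (by positivity)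

lemma det_le_det_exchange (hne : ∀ x, f x ≠ 0) (h : IsRegularDesign f w) (u v : Fin n) :
    (infoMatrix f w).det ≤ (infoMatrix f (exchange f w u v)).det := by
  rw [det_exchange h]
  exact le_mul_of_one_le_right h.posDef.det_pos.le
    (by linarith [exchangeGain_nonneg hne h u v])

lemma batchUpdate_regular_and_det_le (hne : ∀ x, f x ≠ 0) (P : Prop)
    (pairs : List (Fin n × Fin n)) (h : IsRegularDesign f w) :
    IsRegularDesign f (batchUpdate f P w pairs) ∧
      (infoMatrix f w).det ≤ (infoMatrix f (batchUpdate f P w pairs)).det := by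
  induction pairs generalizing w with
  | nil => exact ⟨h, le_rfl⟩
  | cons p ps ih =>
    by_cases hp : ¬ P ∨ IsNullifying f w p.1 p.2
    · have := ih (h.exchange hne p.1 p.2)
      rw [batchUpdate, List.foldl_cons, if_pos hp]
      exact ⟨this.1, (det_le_det_exchange hne h p.1 p.2).trans this.2⟩
    · rw [batchUpdate, List.foldl_cons, if_neg hp]
      exact ih h

/-- The design obtained by transporting the mass of `w` along `σ`. -/
noncomputable def pushforward (σ : Fin n → Fin n) (w : Fin n → ℝ) (y : Fin n) : ℝ :=
  ∑ x, if σ x = y then w x else 0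

lemma pushforward_id (w : Fin n → ℝ) : pushforward id w = w := by
  ext y; simp [pushforward]

lemma pushforward_comp (σ τ : Fin n → Fin n) (w : Fin n → ℝ) :
    pushforward (σ ∘ τ) w = pushforward σ (pushforward τ w) := by
  ext y
  simp only [pushforward, Function.comp_apply, ← Finset.sum_filter]
  rw [Finset.sum_filter, Finset.sum_filter]
  have : ∀ z, (if σ z = y then ∑ x with τ x = z, w x else 0) =
      ∑ x, if τ x = z then (if σ z = y then w x else 0) else 0 := fun z => by
    split_ifs <;> simp [Finset.sum_filter]
  rw [Finset.sum_congr rfl fun z _ => this z, Finset.sum_comm]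
  simp

lemma pushforward_update_id (w : Fin n → ℝ) (u v : Fin n) :
    pushforward (Function.update id u v) w = w + w u • (Pi.single v 1 - Pi.single u 1) := by
  ext y
  have : ∀ x, (if Function.update id u v x = y then w x else 0) =
      (if x = y then w x else 0) +
        if x = u then ((if v = y then w u else 0) - if u = y then w u else 0) else 0 := fun x => by
    rcases eq_or_ne x u with rfl | hx
    · simp
    · simp [hx]
  rw [pushforward, Finset.sum_congr rfl fun x _ => this x, Finset.sum_add_distrib]
  simp [Pi.single_apply, mul_sub, eq_comm]

/-- Step w_u sends all mass of u to v; step -w_v sends all mass of v to u. -/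
lemma IsNullifying.exists_pushforward {u v : Fin n} (h : IsNullifying f w u v) :
    ∃ σ, exchange f w u v = pushforward σ w := by
  rcases h with h | h
  · exact ⟨Function.update id u v, by rw [pushforward_update_id, exchange, h]⟩
  · exact ⟨Function.update id v u, by
      rw [pushforward_update_id, exchange, h, neg_smul, ← smul_neg, neg_sub]⟩

lemma batchUpdate_exists_pushforward {P : Prop} (hP : P) (pairs : List (Fin n × Fin n))
    (w : Fin n → ℝ) : ∃ σ, batchUpdate f P w pairs = pushforward σ w := by
  induction pairs generalizing w with
  | nil => exact ⟨id, (pushforward_id w).symm⟩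
  | cons p ps ih =>
    by_cases hp : ¬ P ∨ IsNullifying f w p.1 p.2
    · obtain ⟨τ, hτ⟩ := (hp.resolve_left (not_not.mpr hP)).exists_pushforward
      obtain ⟨σ, hσ⟩ := ih (exchange f w p.1 p.2)
      refine ⟨σ ∘ τ, ?_⟩
      rw [batchUpdate, List.foldl_cons, if_pos hp, pushforward_comp, ← hτ]
      exact hσ
    · rw [batchUpdate, List.foldl_cons, if_neg hp]
      exact ih w

/-! ### Monotonicity and convergence along a run -/

section Run

variable {γ : ℝ} {w v : ℕ → Fin n → ℝ}

lemma IsRun.isRegularDesign (hne : ∀ x, f x ≠ 0) (hr : IsRun f γ w v) (i : ℕ) :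
    IsRegularDesign f (w i) := by
  induction i with
  | zero => exact hr.init
  | succ i ih =>
    obtain ⟨k, l, ks, ls, -, hv, -, -, hw⟩ := hr.iter i
    rw [hw, hv]
    exact (batchUpdate_regular_and_det_le hne _ _ (ih.exchange hne k l)).1

lemma IsRun.det_exchange_le (hne : ∀ x, f x ≠ 0) (hr : IsRun f γ w v) (i : ℕ) :
    (infoMatrix f (w i)).det ≤ (infoMatrix f (v i)).det ∧
      (infoMatrix f (v i)).det ≤ (infoMatrix f (w (i + 1))).det := by
  obtain ⟨k, l, ks, ls, -, hv, -, -, hw⟩ := hr.iter i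
  have h := hr.isRegularDesign hne i
  rw [hw, hv]
  exact ⟨det_le_det_exchange hne h k l,
    (batchUpdate_regular_and_det_le hne _ _ (h.exchange hne k l)).2⟩

lemma IsRun.exists_pushforward (hr : IsRun f γ w v) {N : ℕ}
    (hN : ∀ i ≥ N, ∀ k l, IsBohningPair f (w i) k l → v i = exchange f (w i) k l →
      IsNullifying f (w i) k l) (j : ℕ) :
    ∃ σ, w (N + j) = pushforward σ (w N) := by
  induction j with
  | zero => exact ⟨id, (pushforward_id _).symm⟩
  | succ j ih =>
    obtain ⟨ρ, hρ⟩ := ih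
    obtain ⟨k, l, ks, ls, hb, hv, -, -, hw⟩ := hr.iter (N + j)
    have hnull := hN (N + j) (Nat.le_add_right _ _) k l hb hv
    obtain ⟨τ, hτ⟩ := hnull.exists_pushforward
    obtain ⟨σ, hσ⟩ := batchUpdate_exists_pushforward (f := f) hnull (batchPairs ks ls) (v (N + j))
    refine ⟨σ ∘ τ ∘ ρ, ?_⟩
    rw [← add_assoc, hw, hσ, hv, hτ, hρ, pushforward_comp, pushforward_comp]

/-- The variance function cannot stay bounded away from `m` along a run. -/
lemma IsRun.not_forall_le_varFun (hne : ∀ x, f x ≠ 0) (hr : IsRun f γ w v) {ψ δ : ℝ}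
    (hψ : Tendsto (fun i => (infoMatrix f (w i)).det) atTop (𝓝 ψ)) (hδ : 0 < δ) :
    ¬ ∀ i k l, IsBohningPair f (w i) k l → m + δ ≤ varFun f (w i) l := by
  intro hlow
  have hreg := hr.isRegularDesign hne
  have hmono : Monotone fun i => (infoMatrix f (w i)).det :=
    monotone_nat_of_le_succ fun i => (hr.det_exchange_le hne i).1.trans (hr.det_exchange_le hne i).2
  have hle := hmono.ge_of_tendsto hψ
  have hψ0 : 0 < ψ := (hreg 0).posDef.det_pos.trans_le (hle 0)
  have hstrict : StrictMono fun i => (infoMatrix f (w i)).det := by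
    refine strictMono_nat_of_lt_succ fun i => lt_of_lt_of_le ?_ (hr.det_exchange_le hne i).2
    obtain ⟨k, l, ks, ls, hb, hv, -⟩ := hr.iter i
    rw [hv, det_exchange (hreg i)]
    have hd : varFun f (w i) k < varFun f (w i) l := by
      linarith [hb.varFun_le (hreg i), hlow i k l hb]
    have := exchangeGain_pos hne (hreg i) hb.1.1 hd
    exact lt_mul_of_one_lt_right (hreg i).posDef.det_pos (by linarith)
  obtain ⟨N, hN⟩ : ∃ N, ∀ i ≥ N, ∀ k l, IsBohningPair f (w i) k l →
      v i = exchange f (w i) k l → IsNullifying f (w i) k l := by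
    obtain ⟨k₀, _, _, _, hb₀, -⟩ := hr.iter 0
    have hm : (0 : ℝ) < m := (varFun_pos (hreg 0) (hne k₀)).trans_le (hb₀.varFun_le (hreg 0))
    set c := δ ^ 2 / (4 * (m * (m + δ)))
    have hc : 0 < c := by positivity
    -- Beyond N the determinant exceeds ψ / (1 + c), so one more gain of factor 1 + c would
    -- overshoot ψ.
    obtain ⟨N, hN⟩ := eventually_atTop.mp
      (hψ.eventually_const_lt (div_lt_self hψ0 (by linarith : 1 < 1 + c)))
    refine ⟨N, fun i hi k l hb hv => by_contra fun hnull => ?_⟩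
    have hg := hb.le_exchangeGain hne (hreg i) hδ (hlow i k l hb) hnull
    have h1 := (hr.det_exchange_le hne i).2.trans (hle (i + 1))
    rw [hv, det_exchange (hreg i)] at h1
    have h2 := (div_lt_iff₀ (by linarith)).mp (hN i hi)
    have h3 := mul_le_mul_of_nonneg_left (add_le_add_right hg 1) (hreg i).posDef.det_pos.le
    linarith
  choose σ hσ using hr.exists_pushforward hN
  -- Pigeonhole: there are finitely many self-maps of the design space.
  obtain ⟨i, j, hij, h⟩ := Finite.exists_ne_map_eq_of_infinite σ
  have hw : w (N + i) = w (N + j) := by rw [hσ, hσ, h]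
  exact hij (Nat.add_left_cancel (hstrict.injective (congrArg (fun z => (infoMatrix f z).det) hw)))

end Run

end Rex

theorem mainTheorem1 {n m : ℕ} (f : Fin n → Fin m → ℝ)
    (hspan : Submodule.span ℝ (Set.range f) = ⊤) (hne : ∀ x, f x ≠ 0)
    (γ : ℝ) (hγ : 1 / (m : ℝ) ≤ γ)
    (w v : ℕ → Fin n → ℝ) (hrun : Rex.IsRun f γ w v) :
    ∃ wstar : Fin n → ℝ, Rex.IsDOptimal f wstar ∧
      Tendsto (fun i => Rex.phiD (Rex.infoMatrix f (w i))) atTop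
        (𝓝 (Rex.phiD (Rex.infoMatrix f wstar))) ∧
      Tendsto (fun i => Rex.phiD (Rex.infoMatrix f (v i))) atTop
        (𝓝 (Rex.phiD (Rex.infoMatrix f wstar))) := by
  obtain ⟨k₀, _, _, _, hb₀, -⟩ := hrun.iter 0
  have hreg := hrun.isRegularDesign hne
  have hm : 0 < m := by
    have := (Rex.varFun_pos (hreg 0) (hne k₀)).trans_le (hb₀.varFun_le (hreg 0))
    exact_mod_cast this
  have hm' : (0 : ℝ) < m := by exact_mod_cast hm
  obtain ⟨ws, hws⟩ := Rex.exists_isDOptimal f k₀.pos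
  have hphi : ∀ {a b : ℝ}, 0 ≤ a → a ≤ b → a ^ (1 / (m : ℝ)) ≤ b ^ (1 / (m : ℝ)) :=
    fun ha hab => Real.rpow_le_rpow ha hab (by positivity)
  have hwv : ∀ i, Rex.phiD (Rex.infoMatrix f (w i)) ≤ Rex.phiD (Rex.infoMatrix f (v i)) :=
    fun i => hphi (hreg i).posDef.det_pos.le (hrun.det_exchange_le hne i).1
  have hvopt : ∀ i, Rex.phiD (Rex.infoMatrix f (v i)) ≤ Rex.phiD (Rex.infoMatrix f ws) := by
    intro i
    obtain ⟨k, l, -, -, -, hv, -⟩ := hrun.iter i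
    exact hv ▸ hws.2 _ ((hreg i).exchange hne k l).1
  have hmono : Monotone fun i => (Rex.infoMatrix f (w i)).det := monotone_nat_of_le_succ fun i =>
    (hrun.det_exchange_le hne i).1.trans (hrun.det_exchange_le hne i).2
  have hbdd : BddAbove (Set.range fun i => (Rex.infoMatrix f (w i)).det) := by
    refine ⟨(Rex.infoMatrix f ws).det, ?_⟩
    rintro _ ⟨i, rfl⟩
    exact (Real.rpow_le_rpow_iff (hreg i).posDef.det_pos.le
      (Rex.infoMatrix_posSemidef f hws.1.1).det_nonneg (by positivity)).mp
        ((hwv i).trans (hvopt i))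
  obtain ⟨ψ, hψ⟩ : ∃ ψ, Tendsto (fun i => (Rex.infoMatrix f (w i)).det) atTop (𝓝 ψ) :=
    ⟨_, tendsto_atTop_ciSup hmono hbdd⟩
  have hψ0 : 0 < ψ := (hreg 0).posDef.det_pos.trans_le (hmono.ge_of_tendsto hψ 0)
  have hlim : Tendsto (fun i => Rex.phiD (Rex.infoMatrix f (w i))) atTop
      (𝓝 (ψ ^ (1 / (m : ℝ)))) := hψ.rpow_const (Or.inl hψ0.ne')
  have heq : ψ ^ (1 / (m : ℝ)) = Rex.phiD (Rex.infoMatrix f ws) := by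
    refine le_antisymm (le_of_tendsto' hlim fun i => (hwv i).trans (hvopt i))
      (not_lt.mp fun hlt => ?_)
    set q := ψ ^ (1 / (m : ℝ)) with hq
    have hq0 : 0 < q := Real.rpow_pos_of_pos hψ0 _
    -- δ is chosen so that m + δ = m Φ* / q, the lower bound on max d forced by Φ_D(M(w i)) ≤ q.
    refine hrun.not_forall_le_varFun hne hψ
      (δ := m * (Rex.phiD (Rex.infoMatrix f ws) / q) - m) ?_ fun i k l hb => ?_
    · have := (one_lt_div hq0).mpr hlt
      nlinarith
    · have h1 := Rex.phiD_infoMatrix_le hm (hreg i) hws.1 hb.2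
      have h2 : Rex.phiD (Rex.infoMatrix f (w i)) ≤ q :=
        hphi (hreg i).posDef.det_pos.le (hmono.ge_of_tendsto hψ i)
      have h3 := h1.trans (mul_le_mul_of_nonneg_right h2
        (div_nonneg (Rex.varFun_pos (hreg i) (hne l)).le hm'.le))
      rw [add_sub_cancel, mul_comm, ← le_div_iff₀ hm', div_le_iff₀ hq0, mul_comm]
      exact h3
  rw [heq] at hlim
  exact ⟨ws, hws, hlim, tendsto_of_tendsto_of_tendsto_of_le_of_le hlim tendsto_const_nhds hwv hvopt⟩
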